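/- Fix an infinite domain of values. A schema is a finite set of relation symbols with arities $\geq 0$; an instance over a schema $\mathbf S$ is a set of facts $R(a_1,\dots,a_n)$ with $R\in\mathbf S$, and $\mathrm{adom}(I)$ is the set of values occurring in $I$. A homomorphism $I\to J$ is a map $\mathrm{adom}(I)\to\mathrm{adom}(J)$ sending facts of $I$ to facts of $J$. A Datalog program $P=(\mathbf S_{in},\mathbf S_{out},\mathbf S_{aux},\Sigma)$ consists of disjoint schemas and a finite set $\Sigma$ of rules $R_0(\mathbf x_0) \mathrel{:\!-} R_1(\mathbf x_1),\dots,R_n(\mathbf x_n)$ ($n\ge 0$) with $R_0\in\mathbf S_{out}\cup\mathbf S_{aux}$, $R_1,\dots,R_n\in\mathbf S_{in}\cup\mathbf S_{aux}$, and every variable of $\mathbf x_0$ occurring in the body; the body is regarded as a finite set of atoms. For an $\mathbf S_{in}$-instance $I$, $P(I)$ is the set of $\mathbf S_{out}$-facts in the chase of $I$, i.e. in the union of the stages obtained from $I$ by repeatedly adding all facts derivable by a rule. The program is Boolean if $\mathbf S_{out}$ consists of a single zero-ary relation symbol, and non-recursive if $\mathbf S_{aux}=\emptyset$. Two programs $P,P'$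 with the same $\mathbf S_{in}$ and the same $\mathbf S_{out}$ are equivalent if for every finite $\mathbf S_{in}$-instance $I$ there are homomorphisms $P(I)\to P'(I)$ and $P'(I)\to P(I)$ fixing the elements of $\mathrm{adom}(I)$. The incidence graph of an instance is the bipartite multigraph whose nodes are its elements and its facts, with one edge $(a,f)$ for every occurrence of $a$ in $f$. A program is tree-shaped if for every rule the incidence graph of its body (viewed as an instance over the variables) is acyclic. It is almost monadic if there is a partial function $f$ mapping relations $R\in\mathbf S_{aux}$ to an argument position $f(R)\in\{1,\dots,\mathrm{arity}(R)\}$ (the articulation position; all other positions are non-articulation positions) such that in every rule, each variable occurring in a non-articulation position of an auxiliary relation in the body occurs only once in the body and does not occur in the articulation position of an auxiliary relation in the head. A TAM Datalog program is a tree-shaped almost-monadic Datalog program. A generalized right-adjoint for $P$ is a function $\Omega$ mapping every finite $\mathbf S_{out}$-instance $J$ to a finite set of pairs $(J',\iota)$, where $J'$ is a finite $\mathbf S_{in}$-instance and $\iota$ is a partial function from $\mathrm{adom}(J')$ to $\mathrm{adom}(J)$, such that for every finite or infinite $\mathbf S_{in}$-instance $I$: (a) for every homomorphism $h:P(I)\to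 J$ there are $(J',\iota)\in\Omega(J)$ and a homomorphism $g:I\to J'$ such that $\iota(g(a))$ is defined and equal to $h(a)$ for all $a\in\mathrm{adom}(I)\cap\mathrm{adom}(P(I))$; and (b) for every $(J',\iota)\in\Omega(J)$ and every homomorphism $g:I\to J'$ there is a homomorphism $h:P(I)\to J$ such that $\iota(g(a))$ is defined and equal to $h(a)$ for all $a\in\mathrm{adom}(I)\cap\mathrm{adom}(P(I))$. **Theorem.** For every Boolean non-recursive Datalog program $P$, the following are equivalent: 1. $P$ admits a generalized right-adjoint; 2. $P$ is equivalent to a TAM Datalog program. -/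

import Mathlib

namespace Datalog

universe u v

/-- A schema: finitely many relation symbols, each with an arity (possibly zero). -/
structure Schema where
  Rel : Type
  arity : Rel → ℕ
  finite : Finite Rel

/-- An expression `R(t₁, …, tₙ)` with `n = arity R`. With `V` a domain of values this is a fact;
with `V = ℕ`, read as a set of variables, it is an atom of a rule. -/
structure Atom (S : Schema) (V : Type u) where
  rel : S.Rel
  args : Fin (S.arity rel) → V

/-- The image of a fact under a map of values. -/
def Atom.map {S : Schema} {V : Type u} {W : Type v} (h : V → W) (a : Atom S V) : Atom S W :=
  ⟨a.rel, fun i => h (a.args i)⟩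

/-- Finite instances. -/
abbrev Inst (S : Schema) (V : Type u) := Finset (Atom S V)

/-- Possibly infinite instances. -/
abbrev InstInf (S : Schema) (V : Type u) := Set (Atom S V)

/-- The active domain of an instance. -/
def adom {S : Schema} {V : Type u} (I : InstInf S V) : Set V :=
  {x | ∃ a ∈ I, ∃ i, a.args i = x}

/-- `h` is a homomorphism `I → J`. A homomorphism is a map from `adom I` to `adom J`; here it is
given by a map on all values, of which only the restriction to `adom I` (which automatically has
its image in `adom J`) is ever used. -/
def IsHom {S : Schema} {V : Type u} (h : V → V) (I J : InstInf S V) : Prop :=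
  ∀ a ∈ I, a.map h ∈ J

/-- `I →_X J`: there is a homomorphism `I → J` that fixes all elements of `X` (on which it is
defined). -/
def HomFixing {S : Schema} {V : Type u} (X : Set V) (I J : InstInf S V) : Prop :=
  ∃ h : V → V, IsHom h I J ∧ ∀ x ∈ X ∩ adom I, h x = x

/-- The underlying simple graph of the incidence graph of an instance: its nodes are the elements
of the active domain and the facts, and an element is joined to the facts in which it occurs. -/
def incidenceGraph {S : Schema} {V : Type u} (I : InstInf S V) : SimpleGraph (adom I ⊕ I) :=
  SimpleGraph.fromRel fun p q =>
    ∃ (x : adom I) (a : I) (i : Fin (S.arity a.1.rel)),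
      p = Sum.inl x ∧ q = Sum.inr a ∧ a.1.args i = x.1

/-- The incidence graph of the instance, as a multigraph with one edge for every occurrence of an
element in a fact, is acyclic: there are no parallel edges (no element occurs twice in a fact) and
the underlying simple graph is acyclic. -/
def IsAcyclicInst {S : Schema} {V : Type u} (I : InstInf S V) : Prop :=
  (∀ a ∈ I, Function.Injective a.args) ∧ (incidenceGraph I).IsAcyclic

/-- The disjoint union of an input, an output and an auxiliary schema. -/
def Schema.full (σ τ α : Schema) : Schema where
  Rel := σ.Rel ⊕ τ.Rel ⊕ α.Rel
  arity := Sum.elim σ.arity (Sum.elim τ.arity α.arity)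
  finite := by
    have := σ.finite
    have := τ.finite
    have := α.finite
    infer_instance

/-- An input atom, as an atom over the full schema. -/
def inAtom {σ τ α : Schema} {V : Type u} (R : σ.Rel) (x : Fin (σ.arity R) → V) :
    Atom (Schema.full σ τ α) V :=
  ⟨Sum.inl R, x⟩

/-- An output atom, as an atom over the full schema. -/
def outAtom {σ τ α : Schema} {V : Type u} (R : τ.Rel) (x : Fin (τ.arity R) → V) :
    Atom (Schema.full σ τ α) V :=
  ⟨Sum.inr (Sum.inl R), x⟩

/-- An auxiliary atom, as an atom over the full schema. -/
def auxAtom {σ τ α : Schema} {V : Type u} (R : α.Rel) (x : Fin (α.arity R) → V) :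
    Atom (Schema.full σ τ α) V :=
  ⟨Sum.inr (Sum.inr R), x⟩

/-- A Datalog rule: a head and a finite set of body atoms, with variables from `ℕ`. The head is
over the output and auxiliary relations, the body over the input and auxiliary relations, and
every variable of the head occurs in the body. -/
structure Rule (σ τ α : Schema) where
  head : Atom (Schema.full σ τ α) ℕ
  body : Finset (Atom (Schema.full σ τ α) ℕ)
  head_rel : ∀ R : σ.Rel, head.rel ≠ Sum.inl R
  body_rel : ∀ a ∈ body, ∀ R : τ.Rel, a.rel ≠ Sum.inr (Sum.inl R)
  safe : ∀ i, head.args i ∈ adom (body : Set (Atom (Schema.full σ τ α) ℕ))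

/-- A Datalog program with input schema `σ` and output schema `τ`: an auxiliary schema and a
finite set of rules. -/
structure Program (σ τ : Schema) where
  aux : Schema
  rules : Finset (Rule σ τ aux)

namespace Program

variable {σ τ : Schema} {V : Type u}

/-- The stages of the chase of the input instance `I`. -/
def chaseStage (P : Program σ τ) (I : InstInf σ V) : ℕ → InstInf (Schema.full σ τ P.aux) V
  | 0 => {b | ∃ a ∈ I, b = inAtom a.rel a.args}
  | n + 1 => P.chaseStage I n ∪
      {b | ∃ r ∈ P.rules, ∃ g : ℕ → V,
        (∀ a ∈ r.body, a.map g ∈ P.chaseStage I n) ∧ b = r.head.map g}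

/-- The chase of `I`. -/
def chase (P : Program σ τ) (I : InstInf σ V) : InstInf (Schema.full σ τ P.aux) V :=
  ⋃ n, P.chaseStage I n

/-- The output `P(I)`: the reduct of the chase to the output schema. -/
def eval (P : Program σ τ) (I : InstInf σ V) : InstInf τ V :=
  {a | outAtom a.rel a.args ∈ P.chase I}

/-- The output schema consists of a single zero-ary relation symbol. -/
def IsBoolean (_P : Program σ τ) : Prop :=
  ∃ Ans : τ.Rel, τ.arity Ans = 0 ∧ ∀ R : τ.Rel, R = Ans

/-- The auxiliary schema is empty. -/
def IsNonrecursive (P : Program σ τ) : Prop :=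
  IsEmpty P.aux.Rel

/-- Equivalence of programs: `P(I) ↔_{adom(I)} Q(I)` for all finite instances `I` with values
in `V`. -/
def Equivalent (V : Type u) (P Q : Program σ τ) : Prop :=
  ∀ I : Inst σ V,
    HomFixing (adom (I : InstInf σ V)) (P.eval (I : InstInf σ V)) (Q.eval (I : InstInf σ V)) ∧
    HomFixing (adom (I : InstInf σ V)) (Q.eval (I : InstInf σ V)) (P.eval (I : InstInf σ V))

/-- The incidence graph of (the canonical instance of) every rule is acyclic. -/
def IsTreeShaped (P : Program σ τ) : Prop :=
  ∀ r ∈ P.rules, IsAcyclicInst (r.body : InstInf (Schema.full σ τ P.aux) ℕ)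

/-- There is an articulation function `f`, that is, a partial function picking an argument
position of auxiliary relations, such that in every rule, each variable that occurs in a
non-articulation position of an auxiliary relation in the body has only one occurrence in the body
and does not occur in the articulation position of an auxiliary relation in the head. -/
def IsAlmostMonadic (P : Program σ τ) : Prop :=
  ∃ f : (R : P.aux.Rel) → Option (Fin (P.aux.arity R)),
    ∀ r ∈ P.rules, ∀ (R : P.aux.Rel) (x : Fin (P.aux.arity R) → ℕ), auxAtom R x ∈ r.body →
      ∀ i, f R ≠ some i →
        (∃! o : (a : Atom (Schema.full σ τ P.aux) ℕ) ×
              Fin ((Schema.full σ τ P.aux).arity a.rel),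
            o.1 ∈ r.body ∧ o.1.args o.2 = x i) ∧
        ∀ (R' : P.aux.Rel) (y : Fin (P.aux.arity R') → ℕ), r.head = auxAtom R' y →
          ∀ j, f R' = some j → y j ≠ x i

/-- TAM Datalog: tree-shaped and almost monadic. -/
def IsTAM (P : Program σ τ) : Prop :=
  P.IsTreeShaped ∧ P.IsAlmostMonadic

/-- `Ω` is a generalized right-adjoint for `P`. It sends every finite output instance `J` to a
finite set of pairs `(J', ι)`, where `J'` is a finite input instance and `ι` is a partial function
from `adom J'` to `adom J`, such that for all (possibly infinite) input instances `I` one has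
`P(I) → J` iff `I → J'` for some `(J', ι) ∈ Ω J`, where every homomorphism `h` witnessing one side
has a homomorphism `g` witnessing the other side with `ι ∘ g = h` on `adom I ∩ adom P(I)`. -/
def IsGeneralizedRightAdjoint (P : Program σ τ)
    (Ω : Inst τ V → Finset (Inst σ V × (V → Option V))) : Prop :=
  ∀ J : Inst τ V,
    (∀ p ∈ Ω J, ∀ a b : V, p.2 a = some b →
      a ∈ adom (p.1 : InstInf σ V) ∧ b ∈ adom (J : InstInf τ V)) ∧
    ∀ I : InstInf σ V,
      (∀ h : V → V, IsHom h (P.eval I) (J : InstInf τ V) →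
        ∃ p ∈ Ω J, ∃ g : V → V, IsHom g I (p.1 : InstInf σ V) ∧
          ∀ a ∈ adom I ∩ adom (P.eval I), p.2 (g a) = some (h a)) ∧
      (∀ p ∈ Ω J, ∀ g : V → V, IsHom g I (p.1 : InstInf σ V) →
        ∃ h : V → V, IsHom h (P.eval I) (J : InstInf τ V) ∧
          ∀ a ∈ adom I ∩ adom (P.eval I), p.2 (g a) = some (h a))

/-- `P` admits a generalized right-adjoint, for instances with values in `V`. -/
def AdmitsGeneralizedRightAdjoint (V : Type u) (P : Program σ τ) : Prop :=
  ∃ Ω : Inst τ V → Finset (Inst σ V × (V → Option V)), P.IsGeneralizedRightAdjoint Ω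

end Program

end Datalog

/-! Since the output is nullary, only the case of empty output carries content: a generalized
right-adjoint amounts to finitely many finite templates such that `P` rejects `I` (has empty output)
exactly when `I` maps to one of them.

From TAM to templates. Give each value of an instance its type, the set of pointed parts of rule
bodies that map to the chase at that value, and each instance its global type, the set of unpointed
parts that map. There are finitely many of both. For each global type, identifying equal types in
all rejected instances of that type gives one finite template. By `IsTAM.eval_template` a template
is itself rejected: the bodies are trees and auxiliary facts transmit information through one
position only, so a match in the template can be reassembled, atom by atom, inside a genuine
rejected instance.

From templates to TAM. A non-recursive Boolean program is a union of conjunctive queries. Take a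
homomorphism-minimal query and its core `X`, and cut one position of a fact of `X` apart over
infinitely many levels (`shifted`). By pigeonhole a finite template cannot tell the result from `X`,
so some query still holds there. Minimality then yields a section of the projection to `X`, which is
impossible if the cut position lay on a cycle. Hence `X` is acyclic, and replacing every query by
such a core below it gives a tree-shaped program. -/

namespace Datalog

universe u v w

/-! ### Facts, homomorphisms and finiteness -/

section Atoms

variable {S : Schema} {V : Type u} {W : Type v} {X : Type w}

/-- Homomorphisms between instances with possibly different domains of values. -/
def HomTo (h : V → W) (I : InstInf S V) (J : InstInf S W) : Prop :=
  ∀ a ∈ I, a.map h ∈ J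

theorem Atom.map_map (a : Atom S V) (h : V → W) (k : W → X) :
    (a.map h).map k = a.map (k ∘ h) := rfl

theorem Atom.map_congr {a : Atom S V} {h k : V → W} (H : ∀ i, h (a.args i) = k (a.args i)) :
    a.map h = a.map k := by
  simp [Atom.map, H]

theorem Atom.map_eq_self {a : Atom S V} {h : V → V} (H : ∀ i, h (a.args i) = a.args i) :
    a.map h = a := by
  cases a; simp_all [Atom.map]

theorem mem_adom {I : InstInf S V} {a : Atom S V} (ha : a ∈ I) (i) : a.args i ∈ adom I :=
  ⟨a, ha, i, rfl⟩

theorem HomTo.comp {I : InstInf S V} {J : InstInf S W} {K : InstInf S X} {h : V → W} {k : W → X}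
    (hk : HomTo k J K) (hh : HomTo h I J) : HomTo (k ∘ h) I K :=
  fun a ha => hk _ (hh a ha)

theorem HomTo.mono {I I' : InstInf S V} {J : InstInf S W} {h : V → W}
    (hh : HomTo h I J) (hI : I' ⊆ I) : HomTo h I' J :=
  fun a ha => hh a (hI ha)

theorem HomTo.congr {I : InstInf S V} {J : InstInf S W} {h k : V → W}
    (hh : HomTo h I J) (H : ∀ x ∈ adom I, h x = k x) : HomTo k I J := by
  intro a ha
  rw [← Atom.map_congr fun i => H _ (mem_adom ha i)]
  exact hh a ha

theorem homTo_id (I : InstInf S V) : HomTo id I I := fun _ ha => ha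

theorem adom_finite {I : InstInf S V} (hI : I.Finite) : (adom I).Finite := by
  have : adom I = ⋃ a ∈ I, Set.range a.args := by
    ext x; simp [adom]
  rw [this]
  exact hI.biUnion fun a _ => Set.finite_range _

theorem finite_atoms_over {s : Set V} (hs : s.Finite) :
    {a : Atom S V | ∀ i, a.args i ∈ s}.Finite := by
  have := S.finite
  have : {a : Atom S V | ∀ i, a.args i ∈ s} ⊆
      ⋃ R : S.Rel, (fun x => (⟨R, x⟩ : Atom S V)) '' (Set.univ.pi fun _ => s) := by
    rintro ⟨R, x⟩ h
    simp only [Set.mem_iUnion]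
    exact ⟨R, x, fun i _ => h i, rfl⟩
  exact (Set.finite_iUnion fun R => (Set.Finite.pi fun _ => hs).image _).subset this

end Atoms

/-! ### Acyclicity as absence of links between positions of a fact -/

section Acyclic

variable {S : Schema} {V : Type u}

/-- Reachability of elements along the facts of an instance. -/
def Linked (C : InstInf S V) : V → V → Prop :=
  Relation.ReflTransGen fun x y => ∃ a ∈ C, ∃ i j, a.args i = x ∧ a.args j = y

/-- No two argument positions of a fact are linked by the remaining facts. -/
def Unlinked (B : InstInf S V) : Prop :=
  ∀ f ∈ B, ∀ i j, i ≠ j → ¬ Linked (B \ {f}) (f.args i) (f.args j)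

theorem Linked.symm {C : InstInf S V} {x y : V} (h : Linked C x y) : Linked C y x := by
  induction h with
  | refl => exact Relation.ReflTransGen.refl
  | tail _ hbc ih =>
    obtain ⟨a, ha, i, j, hi, hj⟩ := hbc
    exact Relation.ReflTransGen.head ⟨a, ha, j, i, hj, hi⟩ ih

theorem Linked.trans {C : InstInf S V} {x y z : V} (h : Linked C x y) (h' : Linked C y z) :
    Linked C x z :=
  Relation.ReflTransGen.trans h h'

theorem Linked.refl {C : InstInf S V} (x : V) : Linked C x x := Relation.ReflTransGen.refl

theorem linked_of_mem {C : InstInf S V} {a : Atom S V} (ha : a ∈ C) (i j) :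
    Linked C (a.args i) (a.args j) :=
  Relation.ReflTransGen.single ⟨a, ha, i, j, rfl, rfl⟩

theorem Linked.mono {C C' : InstInf S V} (hC : C ⊆ C') {x y : V} (h : Linked C x y) :
    Linked C' x y :=
  Relation.ReflTransGen.mono (fun _ _ ⟨a, ha, h⟩ => ⟨a, hC ha, h⟩) _ _ h

theorem Unlinked.mono {B B' : InstInf S V} (hB : B' ⊆ B) (h : Unlinked B) : Unlinked B' :=
  fun f hf i j hij hl => h f (hB hf) i j hij (hl.mono (Set.sdiff_subset_sdiff_left hB))

theorem incidenceGraph_adj_inl_inr {B : InstInf S V} {x : adom B} {f : B} :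
    (incidenceGraph B).Adj (Sum.inl x) (Sum.inr f) ↔ ∃ i, f.1.args i = x.1 := by
  constructor
  · rintro ⟨-, ⟨x', f', i, h1, h2, h3⟩ | ⟨x', f', i, h1, h2, h3⟩⟩
    · cases h1; cases h2; exact ⟨i, h3⟩
    · cases h1
  · rintro ⟨i, h⟩
    exact ⟨by simp, Or.inl ⟨x, f, i, rfl, rfl, h⟩⟩

theorem incidenceGraph_adj_cases {B : InstInf S V} {p q : adom B ⊕ B}
    (h : (incidenceGraph B).Adj p q) :
    ∃ (x : adom B) (f : B), (∃ i, f.1.args i = x.1) ∧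
      ((p = Sum.inl x ∧ q = Sum.inr f) ∨ (p = Sum.inr f ∧ q = Sum.inl x)) := by
  obtain ⟨-, ⟨x', f', i, h1, h2, h3⟩ | ⟨x', f', i, h1, h2, h3⟩⟩ := h
  · exact ⟨x', f', ⟨i, h3⟩, Or.inl ⟨h1, h2⟩⟩
  · exact ⟨x', f', ⟨i, h3⟩, Or.inr ⟨h2, h1⟩⟩

theorem Unlinked.isAcyclicInst {B : InstInf S V} (hB : Unlinked B) : IsAcyclicInst B := by
  refine ⟨fun a ha i j hij => ?_, ?_⟩
  · by_contra hne
    refine hB a ha i j hne ?_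
    rw [hij]
    exact Linked.refl _
  rw [SimpleGraph.isAcyclic_iff_forall_adj_isBridge]
  suffices H : ∀ (x : adom B) (f : B), (incidenceGraph B).Adj (Sum.inl x) (Sum.inr f) →
      (incidenceGraph B).IsBridge s(Sum.inl x, Sum.inr f) by
    intro p q hpq
    obtain ⟨x, f, -, ⟨rfl, rfl⟩ | ⟨rfl, rfl⟩⟩ := incidenceGraph_adj_cases hpq
    · exact H x f hpq
    · rw [Sym2.eq_swap]
      exact H x f hpq.symm
  intro x f hxf
  rw [SimpleGraph.isBridge_iff]
  obtain ⟨i, hi⟩ := incidenceGraph_adj_inl_inr.1 hxf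
  intro hr
  -- A walk from `x` that avoids the edge to `f` never visits `f`: entering through another position
  -- would link two positions of `f` by the other facts.
  have key : ∀ p : adom B ⊕ B,
      ((incidenceGraph B).deleteEdges {s(Sum.inl x, Sum.inr f)}).Reachable (Sum.inl x) p →
      (∀ y, p = Sum.inl y → Linked (B \ {f.1}) x.1 y.1) ∧
      (∀ g, p = Sum.inr g → g ≠ f ∧ ∀ j, Linked (B \ {f.1}) x.1 (g.1.args j)) := by
    intro p hp
    rw [SimpleGraph.reachable_iff_reflTransGen] at hp
    induction hp with
    | refl => exact ⟨fun y hy => by cases hy; exact Linked.refl _, fun g hg => by cases hg⟩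
    | @tail p q _ hpq ih =>
      rw [SimpleGraph.deleteEdges_adj] at hpq
      obtain ⟨hpq, hne⟩ := hpq
      obtain ⟨y, g, ⟨j, hj⟩, ⟨rfl, rfl⟩ | ⟨rfl, rfl⟩⟩ := incidenceGraph_adj_cases hpq
      · refine ⟨fun y hy => (by cases hy), fun g' hg' => ?_⟩
        cases hg'
        have hy := ih.1 y rfl
        by_cases hgf : g = f
        · subst hgf
          exfalso
          refine hB g g.2 i j ?_ (by rw [hi, hj]; exact hy)
          rintro rfl
          apply hne
          have : y = x := Subtype.ext (hj.symm.trans hi)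
          simp [this]
        · have hg : g.1 ∈ B \ {f.1} := ⟨g.2, fun h => hgf (Subtype.ext h)⟩
          refine ⟨hgf, fun j' => hy.trans ?_⟩
          rw [← hj]
          exact linked_of_mem hg _ _
      · refine ⟨fun y' hy' => ?_, fun g' hg' => by cases hg'⟩
        cases hy'
        rw [← hj]
        exact (ih.2 g rfl).2 j
  exact ((key _ hr).2 f rfl).1 rfl

/-- A link between two positions of `f`, closed up through `f`, would bypass an edge at `f`, but
every edge of an acyclic graph is a bridge. -/
theorem IsAcyclicInst.unlinked {B : InstInf S V} (hB : IsAcyclicInst B) : Unlinked B := by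
  intro f hf i j hij hl
  have hne : f.args i ≠ f.args j := fun h => hij (hB.1 f hf h)
  have hadj : (incidenceGraph B).Adj (Sum.inl ⟨_, mem_adom hf i⟩) (Sum.inr ⟨f, hf⟩) :=
    incidenceGraph_adj_inl_inr.2 ⟨i, rfl⟩
  have hbr := SimpleGraph.isAcyclic_iff_forall_adj_isBridge.1 hB.2 hadj
  rw [SimpleGraph.isBridge_iff] at hbr
  apply hbr
  have key : ∀ y, Linked (B \ {f}) (f.args i) y → ∀ hy : y ∈ adom B,
      ((incidenceGraph B).deleteEdges
        {s(Sum.inl ⟨_, mem_adom hf i⟩, Sum.inr ⟨f, hf⟩)}).Reachable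
        (Sum.inl ⟨_, mem_adom hf i⟩) (Sum.inl ⟨y, hy⟩) := by
    intro y hy
    induction hy with
    | refl => exact fun _ => SimpleGraph.Reachable.refl _
    | tail _ hbc ih =>
      obtain ⟨a, ha, k, l, rfl, rfl⟩ := hbc
      intro hy
      refine (ih (mem_adom ha.1 k)).trans ?_
      have hstep : ∀ k, ((incidenceGraph B).deleteEdges
          {s(Sum.inl ⟨_, mem_adom hf i⟩, Sum.inr ⟨f, hf⟩)}).Adj
          (Sum.inl ⟨a.args k, mem_adom ha.1 k⟩) (Sum.inr ⟨a, ha.1⟩) := by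
        intro k
        rw [SimpleGraph.deleteEdges_adj]
        refine ⟨incidenceGraph_adj_inl_inr.2 ⟨k, rfl⟩, ?_⟩
        have := ha.2
        simp_all
      exact (hstep k).reachable.trans (hstep l).symm.reachable
  refine (key _ hl (mem_adom hf j)).trans (SimpleGraph.Adj.reachable ?_)
  rw [SimpleGraph.deleteEdges_adj]
  refine ⟨incidenceGraph_adj_inl_inr.2 ⟨j, rfl⟩, ?_⟩
  simpa using Ne.symm hne

/-- Homomorphisms on the facts other than `f` that agree with a fact `⟨f.rel, w⟩` of the target at
one position of `f` each can be glued to a homomorphism that sends `f` to that fact. -/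
theorem Unlinked.exists_glue {W : Type v} {B : InstInf S V} (hB : Unlinked B) {f : Atom S V}
    (hf : f ∈ B) {J : InstInf S W} {w : Fin (S.arity f.rel) → W}
    (hw : (⟨f.rel, w⟩ : Atom S W) ∈ J)
    (h₀ : ∃ k, HomTo k (B \ {f}) J) (h : ∀ i, ∃ k, HomTo k (B \ {f}) J ∧ k (f.args i) = w i) :
    ∃ k, HomTo k B J ∧ ∀ i, k (f.args i) = w i := by
  classical
  obtain ⟨k₀, hk₀⟩ := h₀
  choose k hk hkw using h
  -- Each component of `B \ {f}` touches at most one position of `f`, and that position selects the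
  -- map used on it; untouched components use `k₀`.
  let L : V → Prop := fun y => ∃ i, Linked (B \ {f}) (f.args i) y
  let K : V → W := fun y => if hy : L y then k hy.choose y else k₀ y
  have hK : ∀ i y, Linked (B \ {f}) (f.args i) y → K y = k i y := by
    intro i y hy
    have hL : L y := ⟨i, hy⟩
    have : hL.choose = i := by
      by_contra hne
      exact hB f hf _ _ hne (hL.choose_spec.trans hy.symm)
    simp only [K, dif_pos hL, this]
  have hKw : ∀ i, K (f.args i) = w i := fun i => by rw [hK i _ (Linked.refl _), hkw]
  refine ⟨K, fun a ha => ?_, hKw⟩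
  by_cases haf : a = f
  · subst haf
    have : a.map K = ⟨a.rel, w⟩ := by simp [Atom.map, hKw]
    rwa [this]
  · have ha' : a ∈ B \ {f} := ⟨ha, haf⟩
    by_cases hL : ∃ i j, Linked (B \ {f}) (f.args i) (a.args j)
    · obtain ⟨i, j, hij⟩ := hL
      rw [Atom.map_congr fun j' => hK i _ (hij.trans (linked_of_mem ha' j j'))]
      exact hk i a ha'
    · have : a.map K = a.map k₀ := Atom.map_congr fun j => by
        have : ¬ L (a.args j) := fun ⟨i, hi⟩ => hL ⟨i, j, hi⟩
        simp only [K, dif_neg this]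
      rw [this]
      exact hk₀ a ha'

end Acyclic

/-! ### The chase: closure, induction, monotonicity, finite support -/

namespace Program

variable {σ τ : Schema} {V : Type u} {W : Type v}

theorem chaseStage_mono (P : Program σ τ) (I : InstInf σ V) : Monotone (P.chaseStage I) :=
  monotone_nat_of_le_succ fun _ => Set.subset_union_left

theorem inAtom_mem_chase (P : Program σ τ) {I : InstInf σ V} {a : Atom σ V} (ha : a ∈ I) :
    inAtom a.rel a.args ∈ P.chase I :=
  Set.mem_iUnion.2 ⟨0, a, ha, rfl⟩

theorem head_mem_chase (P : Program σ τ) {I : InstInf σ V} {r : Rule σ τ P.aux}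
    (hr : r ∈ P.rules) {g : ℕ → V} (hg : HomTo g (r.body : Set _) (P.chase I)) :
    r.head.map g ∈ P.chase I := by
  have : ∀ a : r.body, ∃ n, a.1.map g ∈ P.chaseStage I n := fun a =>
    Set.mem_iUnion.1 (hg a.1 a.2)
  choose n hn using this
  obtain ⟨N, hN⟩ := (Set.finite_range n).bddAbove
  refine Set.mem_iUnion.2 ⟨N + 1, Or.inr ⟨r, hr, g, fun a ha => ?_, rfl⟩⟩
  exact P.chaseStage_mono I (hN ⟨⟨a, ha⟩, rfl⟩) (hn ⟨a, ha⟩)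

theorem chase_induction (P : Program σ τ) {I : InstInf σ V}
    {p : Atom (Schema.full σ τ P.aux) V → Prop}
    (base : ∀ a ∈ I, p (inAtom a.rel a.args))
    (step : ∀ r ∈ P.rules, ∀ g : ℕ → V, (∀ a ∈ r.body, a.map g ∈ P.chase I ∧ p (a.map g)) →
      p (r.head.map g)) {b : Atom (Schema.full σ τ P.aux) V} (hb : b ∈ P.chase I) : p b := by
  obtain ⟨n, hn⟩ := Set.mem_iUnion.1 hb
  clear hb
  induction n generalizing b with
  | zero =>
    obtain ⟨a, ha, rfl⟩ := hn
    exact base a ha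
  | succ n ih =>
    obtain hn | ⟨r, hr, g, hg, rfl⟩ := hn
    · exact ih hn
    · exact step r hr g fun a ha => ⟨Set.mem_iUnion.2 ⟨n, hg a ha⟩, ih (hg a ha)⟩

theorem chase_homTo (P : Program σ τ) {I : InstInf σ V} {J : InstInf σ W} {h : V → W}
    (hh : HomTo h I J) : HomTo h (P.chase I) (P.chase J) := by
  intro b hb
  refine P.chase_induction (p := fun b => b.map h ∈ P.chase J) ?_ ?_ hb
  · exact fun a ha => P.inAtom_mem_chase (hh a ha)
  · exact fun r hr g hg => P.head_mem_chase hr (g := h ∘ g) fun a ha => (hg a ha).2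

theorem eval_nonempty_of_homTo (P : Program σ τ) {I : InstInf σ V} {J : InstInf σ W} {h : V → W}
    (hh : HomTo h I J) (hI : (P.eval I).Nonempty) : (P.eval J).Nonempty := by
  obtain ⟨a, ha⟩ := hI
  exact ⟨a.map h, P.chase_homTo hh _ ha⟩

theorem chase_finite_support (P : Program σ τ) {I : InstInf σ V}
    {b : Atom (Schema.full σ τ P.aux) V} (hb : b ∈ P.chase I) :
    ∃ I₀ : InstInf σ V, I₀.Finite ∧ I₀ ⊆ I ∧ b ∈ P.chase I₀ := by
  refine P.chase_induction
    (p := fun b => ∃ I₀ : InstInf σ V, I₀.Finite ∧ I₀ ⊆ I ∧ b ∈ P.chase I₀) ?_ ?_ hb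
  · exact fun a ha => ⟨{a}, Set.finite_singleton a, by simpa using ha,
      P.inAtom_mem_chase (Set.mem_singleton a)⟩
  · intro r hr g hg
    have : ∀ a : r.body, ∃ I₀ : InstInf σ V, I₀.Finite ∧ I₀ ⊆ I ∧ a.1.map g ∈ P.chase I₀ :=
      fun a => (hg a.1 a.2).2
    choose F hfin hsub hF using this
    refine ⟨⋃ a, F a, Set.finite_iUnion hfin, Set.iUnion_subset hsub,
      P.head_mem_chase hr fun a ha => ?_⟩
    have hid : HomTo id (F ⟨a, ha⟩) (⋃ a, F a) := fun c hc => Set.mem_iUnion.2 ⟨_, hc⟩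
    exact P.chase_homTo hid _ (hF ⟨a, ha⟩)

theorem eval_finite_support (P : Program σ τ) {I : InstInf σ V} (hI : (P.eval I).Nonempty) :
    ∃ I₀ : InstInf σ V, I₀.Finite ∧ I₀ ⊆ I ∧ (P.eval I₀).Nonempty := by
  obtain ⟨a, ha⟩ := hI
  obtain ⟨I₀, h1, h2, h3⟩ := P.chase_finite_support ha
  exact ⟨I₀, h1, h2, a, h3⟩

theorem mem_of_inAtom_mem_chase (P : Program σ τ) {I : InstInf σ V} {R : σ.Rel}
    {x : Fin (σ.arity R) → V} (h : inAtom R x ∈ P.chase I) : (⟨R, x⟩ : Atom σ V) ∈ I := by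
  refine P.chase_induction (p := fun b => ∀ (R : σ.Rel) (x : Fin (σ.arity R) → V),
    b = inAtom R x → (⟨R, x⟩ : Atom σ V) ∈ I) ?_ ?_ h R x rfl
  · rintro ⟨R, x⟩ ha R' x' h
    cases h
    exact ha
  · intro r _ g _ R x h
    exact absurd (congrArg Atom.rel h) (r.head_rel R)

/-- Equivalence only tests finite instances; a derivation uses finitely many facts, so the agreement
extends to infinite ones. -/
theorem eval_nonempty_iff_of_equivalent {P Q : Program σ τ} (h : Equivalent V P Q)
    (I : InstInf σ V) : (P.eval I).Nonempty ↔ (Q.eval I).Nonempty := by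
  have fin : ∀ I : InstInf σ V, I.Finite → ((P.eval I).Nonempty ↔ (Q.eval I).Nonempty) := by
    intro I hI
    obtain ⟨⟨k, hk, -⟩, ⟨l, hl, -⟩⟩ := h hI.toFinset
    rw [hI.coe_toFinset] at hk hl
    exact ⟨fun ⟨a, ha⟩ => ⟨_, hk a ha⟩, fun ⟨a, ha⟩ => ⟨_, hl a ha⟩⟩
  constructor
  · intro hI
    obtain ⟨I₀, h1, h2, h3⟩ := P.eval_finite_support hI
    exact Q.eval_nonempty_of_homTo (h := id) (fun a ha => h2 ha) ((fin I₀ h1).1 h3)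
  · intro hI
    obtain ⟨I₀, h1, h2, h3⟩ := Q.eval_finite_support hI
    exact P.eval_nonempty_of_homTo (h := id) (fun a ha => h2 ha) ((fin I₀ h1).2 h3)

/-! ### Types and templates of a TAM program -/

section Template

variable {σ τ : Schema} (Q : Program σ τ)

/-- The positions at which variables can carry information between rules: all positions of input
relations and the articulation positions of auxiliary relations. -/
def articulation (f : (R : Q.aux.Rel) → Option (Fin (Q.aux.arity R))) :
    (R : (Schema.full σ τ Q.aux).Rel) → Set (Fin ((Schema.full σ τ Q.aux).arity R))
  | Sum.inl _ => Set.univ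
  | Sum.inr (Sum.inl _) => ∅
  | Sum.inr (Sum.inr R) => {i | f R = some i}

/-- The sets of atoms that are part of a rule body. -/
def bodyParts : Set (Finset (Atom (Schema.full σ τ Q.aux) ℕ)) :=
  {B | ∃ r ∈ Q.rules, B ⊆ r.body}

/-- The parts of rule bodies together with a variable of a rule body. -/
def pointedBodyParts : Set (Finset (Atom (Schema.full σ τ Q.aux) ℕ) × ℕ) :=
  Q.bodyParts ×ˢ {x | ∃ r ∈ Q.rules, x ∈ adom (r.body : Set (Atom (Schema.full σ τ Q.aux) ℕ))}

theorem bodyParts_finite : Q.bodyParts.Finite := by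
  classical
  have : Q.bodyParts = ↑(Q.rules.biUnion fun r => r.body.powerset) := by
    ext B; simp [bodyParts]
  rw [this]
  exact Finset.finite_toSet _

theorem pointedBodyParts_finite : Q.pointedBodyParts.Finite := by
  refine Q.bodyParts_finite.prod ?_
  have : {x | ∃ r ∈ Q.rules, x ∈ adom (r.body : Set (Atom (Schema.full σ τ Q.aux) ℕ))} =
      ⋃ r ∈ Q.rules, adom (r.body : Set (Atom (Schema.full σ τ Q.aux) ℕ)) := by
    ext x; simp
  rw [this]
  exact Q.rules.finite_toSet.biUnion fun r _ => adom_finite r.body.finite_toSet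

variable {V : Type u}

/-- The pointed parts of rule bodies that map to the chase of `I` with the point sent to `v`. -/
def pointType (I : InstInf σ V) (v : V) : Set Q.pointedBodyParts :=
  {p | ∃ k : ℕ → V, HomTo k (p.1.1 : Set _) (Q.chase I) ∧ k p.1.2 = v}

/-- The parts of rule bodies that map to the chase of `I`. -/
def globalType (I : InstInf σ V) : Set Q.bodyParts :=
  {B | ∃ k : ℕ → V, HomTo k (B.1 : Set _) (Q.chase I)}

/-- The instances of a given global type on which the program has empty output. -/
def Rejects (G : Set Q.bodyParts) (I : InstInf σ V) : Prop :=
  ¬ (Q.eval I).Nonempty ∧ Q.globalType I = G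

/-- The instance of types realised in the rejected instances of a given global type. -/
def template (code : Set Q.pointedBodyParts → V) (G : Set Q.bodyParts) : InstInf σ V :=
  {a | ∃ I : InstInf σ V, Q.Rejects G I ∧ ∃ b ∈ I, a = b.map (code ∘ Q.pointType I)}

theorem template_finite (code : Set Q.pointedBodyParts → V) (G : Set Q.bodyParts) :
    (Q.template code G).Finite := by
  have := Q.pointedBodyParts_finite.to_subtype
  refine (finite_atoms_over (Set.finite_range code)).subset ?_
  rintro _ ⟨I, -, b, -, rfl⟩ i
  exact ⟨_, rfl⟩

/-- Up to the types at articulation positions, `b` lies in the chase of a rejected instance. -/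
def Realised (f : (R : Q.aux.Rel) → Option (Fin (Q.aux.arity R)))
    (code : Set Q.pointedBodyParts → V) (G : Set Q.bodyParts)
    (b : Atom (Schema.full σ τ Q.aux) V) : Prop :=
  ∃ I : InstInf σ V, Q.Rejects G I ∧
    ∃ w, (⟨b.rel, w⟩ : Atom (Schema.full σ τ Q.aux) V) ∈ Q.chase I ∧
    ∀ i ∈ Q.articulation f b.rel, code (Q.pointType I (w i)) = b.args i

variable {Q}

/-- Input atoms have no non-articulation positions and output atoms do not occur in bodies, so this
is the single-occurrence condition for auxiliary atoms. -/
theorem not_mem_adom_of_nonarticulation {f : (R : Q.aux.Rel) → Option (Fin (Q.aux.arity R))}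
    {r : Rule σ τ Q.aux}
    (hf : ∀ (R : Q.aux.Rel) (x : Fin (Q.aux.arity R) → ℕ), auxAtom R x ∈ r.body →
      ∀ i, f R ≠ some i →
        ∃! o : (a : Atom (Schema.full σ τ Q.aux) ℕ) ×
          Fin ((Schema.full σ τ Q.aux).arity a.rel), o.1 ∈ r.body ∧ o.1.args o.2 = x i)
    {a : Atom (Schema.full σ τ Q.aux) ℕ} (ha : a ∈ r.body) {i}
    (hi : i ∉ Q.articulation f a.rel) {b : Atom (Schema.full σ τ Q.aux) ℕ} (hb : b ∈ r.body) {j}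
    (hij : b.args j = a.args i) :
    (⟨b, j⟩ : (a : Atom (Schema.full σ τ Q.aux) ℕ) × Fin ((Schema.full σ τ Q.aux).arity a.rel))
      = ⟨a, i⟩ := by
  obtain ⟨R | R | R, x⟩ := a
  · exact absurd (Set.mem_univ _) hi
  · exact absurd rfl (r.body_rel _ ha R)
  · exact (hf R x ha i hi).unique ⟨hb, hij⟩ ⟨ha, rfl⟩

/-- Parts of a rule body whose atoms are realised map to the chase of every rejected instance,
with any prescribed point of the right type. -/
theorem exists_homTo_of_realised {f : (R : Q.aux.Rel) → Option (Fin (Q.aux.arity R))}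
    {code : Set Q.pointedBodyParts → V} (hcode : Function.Injective code) {G : Set Q.bodyParts}
    {r : Rule σ τ Q.aux} (hr : r ∈ Q.rules)
    (hacyc : Unlinked (r.body : Set (Atom (Schema.full σ τ Q.aux) ℕ)))
    (hf : ∀ (R : Q.aux.Rel) (x : Fin (Q.aux.arity R) → ℕ), auxAtom R x ∈ r.body →
      ∀ i, f R ≠ some i →
        ∃! o : (a : Atom (Schema.full σ τ Q.aux) ℕ) ×
          Fin ((Schema.full σ τ Q.aux).arity a.rel), o.1 ∈ r.body ∧ o.1.args o.2 = x i)
    {g : ℕ → V} (hg : ∀ a ∈ r.body, Q.Realised f code G (a.map g))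
    (B : Finset (Atom (Schema.full σ τ Q.aux) ℕ)) (hB : B ⊆ r.body) :
    (∀ I : InstInf σ V, Q.Rejects G I → ∃ k : ℕ → V, HomTo k (B : Set _) (Q.chase I)) ∧
    ∀ x ∈ adom (r.body : Set (Atom (Schema.full σ τ Q.aux) ℕ)),
      (∀ a ∈ r.body, ∀ i, a.args i = x → i ∈ Q.articulation f a.rel) →
      ∀ (I : InstInf σ V) (v : V), Q.Rejects G I → code (Q.pointType I v) = g x →
        ∃ k : ℕ → V, HomTo k (B : Set _) (Q.chase I) ∧ k x = v := by
  classical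
  induction B using Finset.strongInduction with
  | H B ih =>
  -- Split off `a`, map it to the fact that realises it, and glue on the remaining atoms, which the
  -- induction hypothesis maps to the same instance.
  have step : ∀ a ∈ B, ∃ I : InstInf σ V, Q.Rejects G I ∧
      ∃ k : ℕ → V, HomTo k (B : Set _) (Q.chase I) ∧
        ∀ i ∈ Q.articulation f a.rel, code (Q.pointType I (k (a.args i))) = g (a.args i) := by
    intro a ha
    obtain ⟨I, hI, w, hw, hwt⟩ := hg a (hB ha)
    obtain ⟨ih₁, ih₂⟩ := ih (B.erase a) (Finset.erase_ssubset ha)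
      ((Finset.erase_subset _ _).trans hB)
    rw [Finset.coe_erase] at ih₁ ih₂
    have hpt : ∀ i, ∃ k : ℕ → V, HomTo k ((B : Set _) \ {a}) (Q.chase I) ∧ k (a.args i) = w i := by
      intro i
      by_cases hi : i ∈ Q.articulation f a.rel
      · refine ih₂ _ (mem_adom (Finset.mem_coe.2 (hB ha)) i) ?_ I (w i) hI (hwt i hi)
        intro b hb j hj
        by_contra hjb
        cases not_mem_adom_of_nonarticulation hf hb hjb (hB ha) hj.symm
        exact hjb hi
      · obtain ⟨k, hk⟩ := ih₁ I hI
        -- The variable occurs nowhere else in the body, so its value may be chosen freely.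
        refine ⟨Function.update k (a.args i) (w i), hk.congr ?_, by simp⟩
        rintro y ⟨b, hb, j, rfl⟩
        rw [Function.update_of_ne]
        intro hj
        cases not_mem_adom_of_nonarticulation hf (hB ha) hi (hB hb.1) hj
        exact hb.2 rfl
    obtain ⟨k, hk, hkw⟩ := (hacyc.mono (Finset.coe_subset.2 hB)).exists_glue
      (Finset.mem_coe.2 ha) hw (ih₁ I hI) hpt
    refine ⟨I, hI, k, hk, fun i hi => ?_⟩
    rw [hkw]
    exact hwt i hi
  have hBp : B ∈ Q.bodyParts := ⟨r, hr, hB⟩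
  have h₁ : ∀ I : InstInf σ V, Q.Rejects G I →
      ∃ k : ℕ → V, HomTo k (B : Set _) (Q.chase I) := by
    intro I hI
    rcases B.eq_empty_or_nonempty with rfl | ⟨a, ha⟩
    · by_cases hV : Nonempty V
      · exact ⟨fun _ => hV.some, fun a ha => absurd ha (by simp)⟩
      · exact absurd ⟨g 0⟩ hV
    · obtain ⟨I', hI', k, hk, -⟩ := step a ha
      -- All rejected instances considered share the global type `G`, so a match of `B` in one of
      -- them gives a match in each.
      have : (⟨B, hBp⟩ : Q.bodyParts) ∈ Q.globalType I' := ⟨k, hk⟩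
      rwa [hI'.2, ← hI.2] at this
  refine ⟨h₁, fun x hx hxa I v hI hv => ?_⟩
  by_cases hxB : x ∈ adom (B : Set (Atom (Schema.full σ τ Q.aux) ℕ))
  · obtain ⟨a, ha, i, rfl⟩ := hxB
    obtain ⟨I', hI', k, hk, hkt⟩ := step a ha
    -- Equal codes mean equal point types, which moves the pointed match from `I'` to `I`.
    have ht := hcode ((hkt i (hxa a (hB ha) i rfl)).trans hv.symm)
    have : (⟨(B, a.args i), hBp, r, hr, hx⟩ : Q.pointedBodyParts) ∈
        Q.pointType I' (k (a.args i)) := ⟨k, hk, rfl⟩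
    rwa [ht] at this
  · obtain ⟨k, hk⟩ := h₁ I hI
    refine ⟨Function.update k x v, hk.congr fun y hy => ?_, by simp⟩
    rw [Function.update_of_ne]
    rintro rfl
    exact hxB hy

/-- A TAM program has empty output on its templates. -/
theorem IsTAM.eval_template (hQ : Q.IsTAM) {code : Set Q.pointedBodyParts → V}
    (hcode : Function.Injective code) (G : Set Q.bodyParts)
    (hG : ∃ I : InstInf σ V, Q.Rejects G I) :
    ¬ (Q.eval (Q.template code G)).Nonempty := by
  obtain ⟨hT, f, hf⟩ := hQ
  rintro ⟨a, ha⟩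
  have key : ∀ b ∈ Q.chase (Q.template code G), Q.Realised f code G b := by
    intro b hb
    refine Q.chase_induction ?_ ?_ hb
    · rintro _ ⟨I, hI, b, hb, rfl⟩
      exact ⟨I, hI, b.args, Q.inAtom_mem_chase hb, fun _ _ => rfl⟩
    · intro r hr g hg
      have hext := exists_homTo_of_realised hcode hr (hT r hr).unlinked
        (fun R x hx i hi => (hf r hr R x hx i hi).1) (fun a ha => (hg a ha).2) r.body
        (Finset.Subset.refl _)
      -- If the head has an articulation position, it is the only one, and the body match must be
      -- pointed at its variable; otherwise any rejected instance will do.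
      by_cases hart : ∃ i, i ∈ Q.articulation f r.head.rel
      · obtain ⟨i, hi⟩ := hart
        have huniq : ∀ j ∈ Q.articulation f r.head.rel, j = i := by
          intro j hj
          have hin := r.head_rel
          generalize r.head = hd at i j hi hj hin
          obtain ⟨R | R | R, x⟩ := hd
          · exact absurd rfl (hin R)
          · exact absurd hi (Set.notMem_empty _)
          · exact Option.some_injective _ (hj.symm.trans hi)
        have hgood : ∀ a ∈ r.body, ∀ j, a.args j = r.head.args i →
            j ∈ Q.articulation f a.rel := by
          intro a ha j hj
          have hin := r.head_rel
          have hfr := hf r hr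
          by_contra hja
          obtain ⟨R | R | R, x⟩ := a
          · exact hja (Set.mem_univ _)
          · exact absurd rfl (r.body_rel _ ha R)
          · have hnot := (hfr R x ha j hja).2
            generalize r.head = hd at i hi hj hin hnot
            obtain ⟨R' | R' | R', y⟩ := hd
            · exact hin R' rfl
            · exact hi
            · exact hnot R' y rfl i hi hj.symm
        obtain ⟨a, ha, j, hj⟩ := r.safe i
        obtain ⟨I, hI, w, hw, hwt⟩ := (hg a ha).2
        have hwj := hwt j (hgood a ha j hj)
        obtain ⟨k, hk, hkx⟩ := hext.2 _ (r.safe i) hgood I (w j) hI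
          (hwj.trans (congrArg g hj))
        refine ⟨I, hI, _, Q.head_mem_chase hr hk, fun i' hi' => ?_⟩
        rw [huniq i' hi', hkx, hwj]
        exact congrArg g hj
      · obtain ⟨I, hI⟩ := hG
        obtain ⟨k, hk⟩ := hext.1 I hI
        exact ⟨I, hI, _, Q.head_mem_chase hr hk, fun i hi => absurd ⟨i, hi⟩ hart⟩
  obtain ⟨I, hI, w, hw, -⟩ := key _ ha
  exact hI.1 ⟨⟨a.rel, w⟩, hw⟩

end Template

/-! ### From templates to a generalized right-adjoint -/

/-- The instances rejected by a TAM program are those that map to one of finitely many finite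
templates. -/
theorem IsTAM.exists_templates {σ τ : Schema} {V : Type u} [Infinite V] {Q : Program σ τ}
    (hQ : Q.IsTAM) : ∃ D : Set (InstInf σ V), D.Finite ∧ (∀ T ∈ D, T.Finite) ∧
      ∀ I : InstInf σ V, ¬ (Q.eval I).Nonempty ↔ ∃ T ∈ D, ∃ g : V → V, HomTo g I T := by
  have := Q.pointedBodyParts_finite.to_subtype
  have := Q.bodyParts_finite.to_subtype
  obtain ⟨n, ⟨e⟩⟩ := Finite.exists_equiv_fin (Set Q.pointedBodyParts)
  let code : Set Q.pointedBodyParts → V := fun t => Infinite.natEmbedding V (e t)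
  have hcode : Function.Injective code := fun s t h =>
    e.injective (Fin.val_injective ((Infinite.natEmbedding V).injective h))
  refine ⟨Q.template code '' {G | ∃ I : InstInf σ V, Q.Rejects G I},
    (Set.toFinite _).image _, ?_, fun I => ⟨fun hI => ?_, ?_⟩⟩
  · rintro _ ⟨G, -, rfl⟩
    exact Q.template_finite code G
  · have hr : Q.Rejects (Q.globalType I) I := ⟨hI, rfl⟩
    exact ⟨_, ⟨_, ⟨I, hr⟩, rfl⟩, code ∘ Q.pointType I, fun a ha => ⟨I, hr, a, ha, rfl⟩⟩
  · rintro ⟨_, ⟨G, hG, rfl⟩, g, hg⟩ hI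
    exact hQ.eval_template hcode G hG (Q.eval_nonempty_of_homTo hg hI)

/-- A Boolean program that is equivalent to a TAM program admits a generalized right-adjoint. -/
theorem IsTAM.admitsGeneralizedRightAdjoint {σ τ : Schema} {V : Type u} [Infinite V]
    {P Q : Program σ τ} (hP : P.IsBoolean) (hQ : Q.IsTAM) (hPQ : Equivalent V P Q) :
    P.AdmitsGeneralizedRightAdjoint V := by
  classical
  obtain ⟨Ans, hAns, huniq⟩ := hP
  have harity : ∀ R : τ.Rel, IsEmpty (Fin (τ.arity R)) := by
    intro R
    rw [huniq R, hAns]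
    infer_instance
  have hatom : ∀ a b : Atom τ V, a = b := by
    rintro ⟨R, x⟩ ⟨R', x'⟩
    obtain rfl : R = R' := (huniq R).trans (huniq R').symm
    have := harity R
    rw [Subsingleton.elim x x']
  have hadom : ∀ J : InstInf τ V, adom J = ∅ := by
    intro J
    ext x
    simp only [adom, Set.mem_ofPred_eq, Set.mem_empty_iff_false, iff_false]
    rintro ⟨a, -, i, -⟩
    exact (harity a.rel).false i
  obtain ⟨D, hD, hDfin, hDspec⟩ := hQ.exists_templates (V := V)
  let v₀ : V := Infinite.natEmbedding V 0
  have hfull := finite_atoms_over (S := σ) (Set.finite_singleton v₀)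
  -- For nonempty `J` every instance must be accepted, so the target is the instance of all facts
  -- over one value. Output instances have no values, hence `ι` is nowhere defined.
  let Ω : Inst τ V → Finset (Inst σ V × (V → Option V)) := fun J =>
    if J = ∅ then hD.toFinset.attach.image fun T =>
      ((hDfin T.1 (hD.mem_toFinset.1 T.2)).toFinset, fun _ => none)
    else {(hfull.toFinset, fun _ => none)}
  refine ⟨Ω, fun J => ⟨?_, fun I => ?_⟩⟩
  · intro p hp a b hab
    exfalso
    by_cases hJ : J = ∅
    · simp only [Ω, if_pos hJ, Finset.mem_image] at hp
      obtain ⟨T, -, rfl⟩ := hp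
      cases hab
    · simp only [Ω, if_neg hJ, Finset.mem_singleton] at hp
      subst hp
      cases hab
  · simp only [hadom, Set.inter_empty, Set.mem_empty_iff_false, false_implies, implies_true,
      and_true]
    by_cases hJ : J = ∅
    · subst hJ
      have hev : ∀ h : V → V, IsHom h (P.eval I) ((∅ : Inst τ V) : InstInf τ V) ↔
          ¬ (Q.eval I).Nonempty := by
        intro h
        rw [← eval_nonempty_iff_of_equivalent hPQ I]
        exact ⟨fun hh ⟨a, ha⟩ => by simpa using hh a ha, fun hh a ha => absurd ⟨a, ha⟩ hh⟩
      simp only [hev, hDspec]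
      constructor
      · rintro - ⟨T, hT, g, hg⟩
        refine ⟨((hDfin T hT).toFinset, fun _ => none), ?_, g, ?_⟩
        · simp only [Ω, if_true, Finset.mem_image]
          exact ⟨⟨T, hD.mem_toFinset.2 hT⟩, Finset.mem_attach _ _, rfl⟩
        · rw [Set.Finite.coe_toFinset]
          exact hg
      · intro p hp g hg
        simp only [Ω, if_true, Finset.mem_image] at hp
        obtain ⟨⟨T, hT⟩, -, rfl⟩ := hp
        rw [Set.Finite.coe_toFinset] at hg
        exact ⟨id, T, hD.mem_toFinset.1 hT, g, hg⟩
    · obtain ⟨a₀, ha₀⟩ := Finset.nonempty_iff_ne_empty.2 hJ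
      have hev : ∀ h : V → V, IsHom h (P.eval I) (J : InstInf τ V) := fun h a _ => by
        rw [hatom (a.map h) a₀]
        exact ha₀
      refine ⟨fun _ _ => ⟨(hfull.toFinset, fun _ => none), ?_, fun _ => v₀, ?_⟩,
        fun _ _ _ _ => ⟨id, hev _⟩⟩
      · simp only [Ω, if_neg hJ, Finset.mem_singleton]
      · rw [Set.Finite.coe_toFinset]
        exact fun a _ i => rfl

end Program

/-! ### Cores and cutting a fact over infinitely many levels -/

section Core

variable {S : Schema} {V : Type u}

/-- Every finite instance is homomorphically equivalent to a finite instance all of whose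
endomorphisms have an inverse endomorphism. -/
theorem exists_core (F : Finset (Atom S V)) : ∃ X : Finset (Atom S V),
    (∃ h : V → V, HomTo h (X : InstInf S V) (F : InstInf S V)) ∧
    (∃ h : V → V, HomTo h (F : InstInf S V) (X : InstInf S V)) ∧
    ∀ e : V → V, HomTo e (X : InstInf S V) (X : InstInf S V) →
      ∃ s : V → V, HomTo s (X : InstInf S V) (X : InstInf S V) ∧
        ∀ x ∈ adom (X : InstInf S V), e (s x) = x := by
  classical
  let C : Set (Finset (Atom S V)) := {X | (∃ h : V → V, HomTo h (X : InstInf S V) (F : InstInf S V)) ∧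
    ∃ h : V → V, HomTo h (F : InstInf S V) (X : InstInf S V)}
  have hC : C.Nonempty := ⟨F, ⟨id, homTo_id _⟩, ⟨id, homTo_id _⟩⟩
  obtain ⟨X, hX, hmin⟩ := (measure Finset.card).wf.has_min C hC
  refine ⟨X, hX.1, hX.2, fun e he => ?_⟩
  obtain ⟨⟨h₁, hh₁⟩, ⟨h₂, hh₂⟩⟩ := hX
  have hsub : X.image (Atom.map e) ⊆ X := by
    intro a ha
    obtain ⟨b, hb, rfl⟩ := Finset.mem_image.1 ha
    exact he b hb
  -- `X` has the fewest facts in its homomorphism class, so an endomorphism cannot lose a fact;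
  -- hence `e` permutes the values and its inverse is a homomorphism too.
  have himg : X.image (Atom.map e) = X := by
    refine Finset.eq_of_subset_of_card_le hsub (not_lt.1 (hmin _ ⟨⟨h₁, fun a ha => ?_⟩,
      ⟨e ∘ h₂, fun a ha => ?_⟩⟩))
    · exact hh₁ a (hsub ha)
    · exact Finset.mem_coe.2 (Finset.mem_image_of_mem (Atom.map e) (hh₂ a ha))
  have hpre : ∀ a ∈ X, ∃ b ∈ X, b.map e = a := fun a ha => by
    rw [← himg] at ha
    exact Finset.mem_image.1 ha
  have hfin : (adom (X : InstInf S V)).Finite := adom_finite X.finite_toSet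
  have hsurj : Set.SurjOn e (adom (X : InstInf S V)) (adom (X : InstInf S V)) := by
    rintro _ ⟨a, ha, i, rfl⟩
    obtain ⟨b, hb, rfl⟩ := hpre a ha
    exact ⟨b.args i, mem_adom (Finset.mem_coe.2 hb) i, rfl⟩
  have hmaps : Set.MapsTo e (adom (X : InstInf S V)) (adom (X : InstInf S V)) := by
    rintro _ ⟨a, ha, i, rfl⟩
    exact ⟨a.map e, he a ha, i, rfl⟩
  have hinj : Set.InjOn e (adom (X : InstInf S V)) :=
    (Set.Finite.surjOn_iff_bijOn_of_mapsTo hfin hmaps).1 hsurj |>.injOn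
  rcases isEmpty_or_nonempty V with hV | hV
  · exact ⟨id, homTo_id _, fun x => hV.elim x⟩
  refine ⟨Function.invFunOn e (adom (X : InstInf S V)), fun a ha => ?_, fun x hx =>
    Function.invFunOn_eq (hsurj hx)⟩
  obtain ⟨b, hb, rfl⟩ := hpre a ha
  rw [Atom.map_map, Atom.map_eq_self fun i => ?_]
  · exact hb
  · exact hinj.leftInvOn_invFunOn (mem_adom (Finset.mem_coe.2 hb) i)

/-- The instance `X × ℕ`, where each fact lives on one level, except that position `i` of the
fact `f` is taken from a higher level. -/
def shifted (X : InstInf S V) (f : Atom S V) (i : Fin (S.arity f.rel)) : InstInf S (V × ℕ) :=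
  {b | ∃ m, ∃ a ∈ X, a ≠ f ∧ b = a.map fun y => (y, m)} ∪
  {b | ∃ m m', m < m' ∧ b = ⟨f.rel, fun j => (f.args j, if j = i then m' else m)⟩}

theorem shifted_homTo_fst {X : InstInf S V} {f : Atom S V} (hf : f ∈ X) (i) :
    HomTo Prod.fst (shifted X f i) X := by
  rintro _ (⟨m, a, ha, -, rfl⟩ | ⟨m, m', -, rfl⟩)
  · exact ha
  · exact hf

/-- An instance whose shifted version maps to a finite instance maps to it as well. -/
theorem exists_homTo_of_shifted {W : Type v} {X : InstInf S V} (hX : X.Finite)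
    {f : Atom S V} {i} {D : InstInf S W} (hD : D.Finite) {c : V × ℕ → W}
    (hc : HomTo c (shifted X f i) D) : ∃ h : V → W, HomTo h X D := by
  classical
  have hW : Nonempty W ∨ IsEmpty W := (isEmpty_or_nonempty W).symm
  obtain ⟨⟨w₀⟩⟩ | hW := hW
  swap
  · exact ⟨fun y => c (y, 0), fun a ha => by
      by_cases haf : a = f
      · exact hW.elim (c (f.args i, 0))
      · exact hc _ (Or.inl ⟨0, a, ha, haf, rfl⟩)⟩
  -- Values are retracted to a finite set so that each level has only finitely many possible
  -- colourings.
  let s : Set W := insert w₀ (adom D)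
  have hs : Finite s := ((adom_finite hD).insert w₀).to_subtype
  have : Finite (adom X) := (adom_finite hX).to_subtype
  let r : W → s := fun w => if hw : w ∈ s then ⟨w, hw⟩ else ⟨w₀, Set.mem_insert _ _⟩
  have hr : ∀ w ∈ adom D, (r w : W) = w := fun w hw => by
    have : w ∈ s := Set.mem_insert_of_mem _ hw
    simp [r, this]
  have hc' : HomTo (fun y => (r (c y) : W)) (shifted X f i) D := by
    refine hc.congr ?_
    rintro _ ⟨a, ha, j, rfl⟩
    exact (hr _ ⟨a.map c, hc a ha, j, rfl⟩).symm
  -- Two levels receive the same colouring, so the copy of `f` cut between them looks uncut.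
  obtain ⟨m, m', hne, hmm⟩ := Finite.exists_ne_map_eq_of_infinite
    fun (m : ℕ) (y : adom X) => r (c (y.1, m))
  wlog hlt : m < m' generalizing m m'
  · exact this m' m hne.symm hmm.symm (lt_of_le_of_ne (not_lt.1 hlt) hne.symm)
  refine ⟨fun y => r (c (y, m)), fun a ha => ?_⟩
  by_cases haf : a = f
  · subst haf
    have h := hc' _ (Or.inr ⟨m, m', hlt, rfl⟩)
    convert h using 1
    simp only [Atom.map, Atom.mk.injEq, heq_eq_eq, true_and]
    funext j
    by_cases hj : j = i
    · subst hj
      simpa using congrArg Subtype.val (congrFun hmm ⟨_, mem_adom ha j⟩)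
    · simp [hj]
  · exact hc' _ (Or.inl ⟨m, a, ha, haf, rfl⟩)

/-- If an instance has a section into its shifted version, the shifted position is not linked to
another position of the same fact. -/
theorem not_linked_of_section {X : InstInf S V} {f : Atom S V} (hf : f ∈ X) {i j} (hij : i ≠ j)
    {h : V → V × ℕ} (hh : HomTo h X (shifted X f i)) (hsec : ∀ x ∈ adom X, (h x).1 = x) :
    ¬ Linked (X \ {f}) (f.args i) (f.args j) := by
  have hfst : ∀ a ∈ X, (a.map h).map Prod.fst = a := fun a ha =>
    (Atom.map_map _ _ _).trans (Atom.map_eq_self fun k => hsec _ (mem_adom ha k))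
  -- Facts other than `f` stay within one level, whereas the image of `f` has position `i` strictly
  -- above the others.
  have hlevel : ∀ y, Linked (X \ {f}) (f.args i) y → (h y).2 = (h (f.args i)).2 := by
    intro y hy
    induction hy with
    | refl => rfl
    | tail _ hbc ih =>
      obtain ⟨a, ⟨haX, haf⟩, k, l, rfl, rfl⟩ := hbc
      rw [← ih]
      have hfa := hfst a haX
      obtain ⟨m, b, hb, hbf, hab⟩ | ⟨m, m', hlt, hab⟩ := hh a haX
      · rw [hab] at hfa
        obtain rfl : b = a := hfa
        simp only [Atom.map, Atom.mk.injEq, heq_eq_eq, true_and] at hab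
        rw [congrFun hab l, congrFun hab k]
      · rw [hab] at hfa
        exact absurd hfa.symm haf
  intro hl
  have hfa := hfst f hf
  obtain ⟨m, b, hb, hbf, hab⟩ | ⟨m, m', hlt, hab⟩ := hh f hf
  · rw [hab] at hfa
    exact hbf hfa
  · simp only [Atom.map, Atom.mk.injEq, heq_eq_eq, true_and] at hab
    have h1 := hlevel _ hl
    have h2 := congrArg Prod.snd (congrFun hab i)
    have h3 := congrArg Prod.snd (congrFun hab j)
    simp only [if_true, if_neg hij.symm] at h2 h3
    omega

end Core

/-! ### From a generalized right-adjoint to acyclic rule bodies -/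

namespace Program

variable {σ τ : Schema} {V : Type u}

theorem eval_nonempty_comap {W : Type v} [Nonempty W] (P : Program σ τ) {I : InstInf σ W}
    {e : W → V} (he : Function.Injective e)
    (h : (P.eval (Atom.map e '' I)).Nonempty) : (P.eval I).Nonempty := by
  refine P.eval_nonempty_of_homTo (h := Function.invFun e) ?_ h
  rintro _ ⟨a, ha, rfl⟩
  rw [Atom.map_map, Function.invFun_comp he]
  exact ha

/-- If the program has a generalized right-adjoint, the instances with empty output, over any
countable domain, are those mapping to one of a set of finite templates. -/
theorem AdmitsGeneralizedRightAdjoint.exists_templates [Infinite V] {P : Program σ τ}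
    (hP : P.AdmitsGeneralizedRightAdjoint V) {W : Type v} [Countable W] [Nonempty W] :
    ∃ D : Set (InstInf σ V), (∀ T ∈ D, T.Finite) ∧
      ∀ I : InstInf σ W, ¬ (P.eval I).Nonempty ↔ ∃ T ∈ D, ∃ g : W → V, HomTo g I T := by
  classical
  obtain ⟨Ω, hΩ⟩ := hP
  obtain ⟨c, hc⟩ := exists_injective_nat W
  let e : W → V := Infinite.natEmbedding V ∘ c
  have he : Function.Injective e := (Infinite.natEmbedding V).injective.comp hc
  refine ⟨{T | ∃ p ∈ Ω ∅, T = ↑p.1}, ?_, fun I => ⟨fun hI => ?_, ?_⟩⟩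
  · rintro _ ⟨p, -, rfl⟩
    exact p.1.finite_toSet
  · obtain ⟨p, hp, g, hg, -⟩ := ((hΩ ∅).2 (Atom.map e '' I)).1 id fun a ha =>
      absurd (P.eval_nonempty_comap he (Set.nonempty_of_mem ha)) hI
    exact ⟨_, ⟨p, hp, rfl⟩, g ∘ e, fun a ha => hg _ (Set.mem_image_of_mem _ ha)⟩
  · rintro ⟨_, ⟨p, hp, rfl⟩, g, hg⟩ hI
    have hhom : IsHom (g ∘ Function.invFun e) (Atom.map e '' I) (p.1 : InstInf σ V) := by
      rintro _ ⟨a, ha, rfl⟩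
      rw [Atom.map_map, Function.comp_assoc, Function.invFun_comp he]
      exact hg a ha
    obtain ⟨h, hh, -⟩ := ((hΩ ∅).2 (Atom.map e '' I)).2 p hp _ hhom
    obtain ⟨a, ha⟩ := P.eval_nonempty_of_homTo (h := e) (J := Atom.map e '' I)
      (fun a ha => Set.mem_image_of_mem _ ha) hI
    simpa using hh a ha

/-- The input atoms in the body of a rule. -/
noncomputable def _root_.Datalog.Rule.inputBody {α : Schema} (r : Rule σ τ α) : Finset (Atom σ ℕ) :=
  r.body.preimage (fun a => inAtom a.rel a.args) fun a _ b _ h => by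
    cases a; cases b; cases h; rfl

/-- Without auxiliary relations, bodies hold only input atoms and heads are outputs, so the program
is a union of conjunctive queries evaluated in one step. -/
theorem eval_nonempty_iff {P : Program σ τ} (hP : P.IsNonrecursive) {I : InstInf σ V} :
    (P.eval I).Nonempty ↔ ∃ r ∈ P.rules, ∃ k : ℕ → V, HomTo k (r.inputBody : InstInf σ ℕ) I := by
  constructor
  · rintro ⟨a, ha⟩
    have key : ∀ b ∈ P.chase I, (∃ R : σ.Rel, b.rel = Sum.inl R) ∨
        ∃ r ∈ P.rules, ∃ k : ℕ → V, HomTo k (r.inputBody : InstInf σ ℕ) I := by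
      intro b hb
      refine P.chase_induction (p := fun b => (∃ R : σ.Rel, b.rel = Sum.inl R) ∨
        ∃ r ∈ P.rules, ∃ k : ℕ → V, HomTo k (r.inputBody : InstInf σ ℕ) I) ?_ ?_ hb
      · exact fun a _ => Or.inl ⟨a.rel, rfl⟩
      · refine fun r hr g hg => Or.inr ⟨r, hr, g, fun a ha => ?_⟩
        exact P.mem_of_inAtom_mem_chase (hg _ (Finset.mem_preimage.1 ha)).1
    obtain ⟨R, hR⟩ | h := key _ ha
    · cases hR
    · exact h
  · rintro ⟨r, hr, k, hk⟩
    have hhead := P.head_mem_chase hr (g := k) (I := I) fun a ha => by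
      have hrel := r.body_rel a ha
      obtain ⟨R | R | R, x⟩ := a
      · exact P.inAtom_mem_chase (hk ⟨R, x⟩ (Finset.mem_preimage.2 ha))
      · exact absurd rfl (hrel R)
      · exact (hP.false R).elim
    have hrel := r.head_rel
    generalize r.head = b at hhead hrel
    obtain ⟨R | R | R, x⟩ := b
    · exact absurd rfl (hrel R)
    · exact ⟨⟨R, fun i => k (x i)⟩, hhead⟩
    · exact (hP.false R).elim

/-- Below each rule body there is an unlinked instance on which the program has output. -/
theorem AdmitsGeneralizedRightAdjoint.exists_unlinked [Infinite V] {P : Program σ τ}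
    (hP : P.AdmitsGeneralizedRightAdjoint V) (hN : P.IsNonrecursive) {r : Rule σ τ P.aux}
    (hr : r ∈ P.rules) : ∃ X : Finset (Atom σ ℕ), Unlinked (X : InstInf σ ℕ) ∧
      (∃ h : ℕ → ℕ, HomTo h (X : InstInf σ ℕ) (r.inputBody : InstInf σ ℕ)) ∧
      (P.eval (X : InstInf σ ℕ)).Nonempty := by
  classical
  let le : Rule σ τ P.aux → Rule σ τ P.aux → Prop := fun r r' =>
    ∃ h : ℕ → ℕ, HomTo h (r.inputBody : InstInf σ ℕ) (r'.inputBody : InstInf σ ℕ)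
  have le_refl : ∀ r, le r r := fun r => ⟨id, homTo_id _⟩
  have le_trans : ∀ r r' r'', le r r' → le r' r'' → le r r'' :=
    fun _ _ _ ⟨h, hh⟩ ⟨k, hk⟩ => ⟨k ∘ h, hk.comp hh⟩
  -- A rule below `r` with the fewest rules below it is minimal in the homomorphism preorder.
  obtain ⟨r₀, hr₀, hmin⟩ := Finset.exists_min_image (P.rules.filter fun q => le q r)
    (fun q => (P.rules.filter fun q' => le q' q).card)
    ⟨r, Finset.mem_filter.2 ⟨hr, le_refl r⟩⟩
  rw [Finset.mem_filter] at hr₀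
  have hmin' : ∀ q ∈ P.rules, le q r₀ → le r₀ q := by
    intro q hq hqr
    have hcard := hmin q (Finset.mem_filter.2 ⟨hq, le_trans _ _ _ hqr hr₀.2⟩)
    have hsub : (P.rules.filter fun q' => le q' q) ⊆ P.rules.filter fun q' => le q' r₀ :=
      fun q' hq' => by
        rw [Finset.mem_filter] at hq' ⊢
        exact ⟨hq'.1, le_trans _ _ _ hq'.2 hqr⟩
    have hmem : r₀ ∈ P.rules.filter fun q' => le q' r₀ :=
      Finset.mem_filter.2 ⟨hr₀.1, le_refl r₀⟩
    rw [← Finset.eq_of_subset_of_card_le hsub hcard] at hmem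
    exact (Finset.mem_filter.1 hmem).2
  obtain ⟨X, ⟨h₁, hh₁⟩, ⟨h₂, hh₂⟩, hcore⟩ := exists_core r₀.inputBody
  obtain ⟨h₃, hh₃⟩ := hr₀.2
  have hXne : (P.eval (X : InstInf σ ℕ)).Nonempty :=
    (eval_nonempty_iff hN).2 ⟨r₀, hr₀.1, h₂, hh₂⟩
  refine ⟨X, ?_, ⟨h₃ ∘ h₁, hh₃.comp hh₁⟩, hXne⟩
  intro f hf i j hij
  have hfst := shifted_homTo_fst hf i
  have hne : (P.eval (shifted (X : InstInf σ ℕ) f i)).Nonempty := by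
    by_contra hcon
    let toPair : ℕ → ℕ × ℕ := fun n => (n, 0)
    obtain ⟨D, hD, hspec⟩ := hP.exists_templates (W := ℕ × ℕ)
    obtain ⟨T, hT, c, hc⟩ := (hspec _).1 hcon
    obtain ⟨h, hh⟩ := exists_homTo_of_shifted X.finite_toSet (hD T hT) hc
    refine (hspec (Atom.map toPair '' (X : InstInf σ ℕ))).2 ⟨T, hT, h ∘ Prod.fst, ?_⟩
      (P.eval_nonempty_of_homTo (h := toPair)
        (fun a ha => Set.mem_image_of_mem _ ha) hXne)
    rintro _ ⟨a, ha, rfl⟩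
    exact hh a ha
  obtain ⟨q, hq, k, hk⟩ := (eval_nonempty_iff hN).1 hne
  obtain ⟨l, hl⟩ := hmin' q hq ⟨h₁ ∘ Prod.fst ∘ k, hh₁.comp (hfst.comp hk)⟩
  have hsec : HomTo (k ∘ l ∘ h₁) (X : InstInf σ ℕ) (shifted (X : InstInf σ ℕ) f i) :=
    hk.comp (hl.comp hh₁)
  -- Projecting `hsec` gives an endomorphism of the core; composing with its inverse `s` turns
  -- `hsec` into a true section.
  obtain ⟨s, hs, hsx⟩ := hcore _ (hfst.comp hsec)
  exact not_linked_of_section hf hij (hsec.comp hs) hsx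

theorem unlinked_inAtom {α : Schema} {X : InstInf σ ℕ} (hX : Unlinked X) :
    Unlinked ((fun a : Atom σ ℕ => (inAtom a.rel a.args : Atom (Schema.full σ τ α) ℕ)) '' X) := by
  rintro _ ⟨f, hf, rfl⟩ i j hij hl
  refine hX f hf i j hij (Relation.ReflTransGen.mono ?_ _ _ hl)
  rintro _ _ ⟨_, ⟨⟨a, ha, rfl⟩, haf⟩, k, l, rfl, rfl⟩
  exact ⟨a, ⟨ha, fun h => haf (by rw [Set.mem_singleton_iff.1 h]; rfl)⟩, k, l, rfl, rfl⟩

/-- A Boolean non-recursive program with a generalized right-adjoint is equivalent to a TAM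
program. -/
theorem AdmitsGeneralizedRightAdjoint.exists_isTAM [Infinite V] {P : Program σ τ}
    (hP : P.AdmitsGeneralizedRightAdjoint V) (hB : P.IsBoolean) (hN : P.IsNonrecursive) :
    ∃ Q : Program σ τ, Q.IsTAM ∧ Equivalent V P Q := by
  classical
  obtain ⟨Ans, hAns, huniq⟩ := hB
  have harity : IsEmpty (Fin (τ.arity Ans)) := by
    rw [hAns]
    infer_instance
  have hatom : ∀ a b : Atom τ V, a = b := by
    rintro ⟨R, x⟩ ⟨R', x'⟩
    obtain rfl := huniq R
    obtain rfl := huniq R'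
    rw [Subsingleton.elim x x']
  have hex : ∀ r : P.rules, ∃ X : Finset (Atom σ ℕ), Unlinked (X : InstInf σ ℕ) ∧
      (∃ h : ℕ → ℕ, HomTo h (X : InstInf σ ℕ) (r.1.inputBody : InstInf σ ℕ)) ∧
      (P.eval (X : InstInf σ ℕ)).Nonempty := fun r => hP.exists_unlinked hN r.2
  choose X hX hXr hXP using hex
  let toRule : P.rules → Rule σ τ P.aux := fun r =>
    { head := outAtom Ans harity.elim
      body := (X r).image fun a => inAtom a.rel a.args
      head_rel := fun R h => by cases h
      body_rel := fun a ha R h => by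
        obtain ⟨b, -, rfl⟩ := Finset.mem_image.1 ha
        cases h
      safe := fun i => (harity.false i).elim }
  have hmem : ∀ (r : P.rules) (a : Atom σ ℕ), a ∈ (toRule r).inputBody ↔
      inAtom a.rel a.args ∈ (toRule r).body := fun _ _ => Finset.mem_preimage
  have hbody : ∀ r, (toRule r).inputBody = X r := by
    intro r
    ext a
    rw [hmem]
    refine Finset.mem_image.trans ?_
    constructor
    · rintro ⟨b, hb, hab⟩
      cases a; cases b; cases hab
      exact hb
    · exact fun ha => ⟨a, ha, rfl⟩
  let Q : Program σ τ := ⟨P.aux, P.rules.attach.image toRule⟩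
  have hQN : Q.IsNonrecursive := hN
  have hne : ∀ I : InstInf σ V, (P.eval I).Nonempty ↔ (Q.eval I).Nonempty := by
    intro I
    constructor
    · intro h
      obtain ⟨r, hr, k, hk⟩ := (eval_nonempty_iff hN).1 h
      obtain ⟨l, hl⟩ := hXr ⟨r, hr⟩
      refine (eval_nonempty_iff hQN).2 ⟨toRule ⟨r, hr⟩,
        Finset.mem_image_of_mem _ (Finset.mem_attach _ _), k ∘ l, ?_⟩
      rw [hbody]
      exact hk.comp hl
    · intro h
      obtain ⟨_, hr, k, hk⟩ := (eval_nonempty_iff hQN).1 h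
      obtain ⟨r, -, rfl⟩ := Finset.mem_image.1 hr
      rw [hbody] at hk
      exact P.eval_nonempty_of_homTo hk (hXP r)
  -- With no auxiliary relations the almost-monadic condition is vacuous; only tree shape needs
  -- proof.
  refine ⟨Q, ⟨?_, fun R => (hN.false R).elim, fun _ _ R => (hN.false R).elim⟩, fun I => ?_⟩
  · intro r hr
    obtain ⟨r, -, rfl⟩ := Finset.mem_image.1 hr
    have := (unlinked_inAtom (τ := τ) (α := P.aux) (hX r)).isAcyclicInst
    rwa [← Finset.coe_image] at this
  · refine ⟨⟨id, fun a ha => ?_, fun _ _ => rfl⟩, ⟨id, fun a ha => ?_, fun _ _ => rfl⟩⟩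
    · obtain ⟨b, hb⟩ := (hne _).1 ⟨a, ha⟩
      rwa [hatom (a.map id) b]
    · obtain ⟨b, hb⟩ := (hne _).2 ⟨a, ha⟩
      rwa [hatom (a.map id) b]

end Program

end Datalog

theorem mainTheorem10 {V : Type*} [Infinite V] {σ τ : Datalog.Schema}
    (P : Datalog.Program σ τ) (hBool : P.IsBoolean) (hNonrec : P.IsNonrecursive) :
    P.AdmitsGeneralizedRightAdjoint V ↔
      ∃ Q : Datalog.Program σ τ, Q.IsTAM ∧ Datalog.Program.Equivalent V P Q :=
  ⟨fun h => h.exists_isTAM hBool hNonrec, fun ⟨_, hQ, hPQ⟩ =>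
    hQ.admitsGeneralizedRightAdjoint hBool hPQ⟩
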